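/- For a theory \(T\) in a first-order language \(L\), a theory \(T^*\) in the same language \(L\) is called a model-companion of \(T\) if (i) every model of \(T\) embeds in a model of \(T^*\) and every model of \(T^*\) embeds in a model of \(T\), and (ii) \(T^*\) is model-complete, that is, for every model \(\mathfrak M\) of \(T^*\), the set \(T^*\cup\operatorname{diag}(\mathfrak M)\) axiomatizes a complete theory, where \(\operatorname{diag}(\mathfrak M)\) is the set of all quantifier-free sentences with parameters from \(\mathfrak M\) that are true in \(\mathfrak M\). Let \(\omega\mathrm{DF}\) be the theory, in the language \(\{0,1,-,+,\cdot\}\cup\{\partial_k : k\in\mathbb N\}\) with each \(\partial_k\) a unary operation symbol, of fields (of any characteristic) equipped with derivations \(\partial_0,\partial_1,\partial_2,\dots\) that commute with one another. Theorem. The theory \(\omega\mathrm{DF}\) has no model-companion. -/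

import Mathlib

open FirstOrder

universe u v w

namespace FirstOrder.Language

section ModelCompanion

variable {L : Language.{u, v}}

/-- The (quantifier-free) diagram of a structure `M`: all quantifier-free sentences with
parameters from `M` that are true in `M`. -/
def diagram (L : Language.{u, v}) (M : Type w) [L.Structure M] : L[[M]].Theory :=
  {φ | BoundedFormula.IsQF φ ∧ M ⊨ φ}

/-- A theory `T` is model-complete if, for every model `M` of `T`, the theory `T ∪ diag M` (in the
language with names for the elements of `M`) axiomatizes a complete theory.  The models range over
the universe `w`. -/
def Theory.IsModelComplete (T : L.Theory) : Prop :=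
  ∀ M : T.ModelType.{u, v, w},
    ((L.lhomWithConstants M).onTheory T ∪ L.diagram M).IsComplete

/-- `Ts` is a model-companion of `T`: every model of either theory embeds in a model of the other,
and `Ts` is model-complete.  The models range over the universe `w`. -/
structure Theory.IsModelCompanion (Ts T : L.Theory) : Prop where
  embeds_left : ∀ M : T.ModelType.{u, v, w}, ∃ N : Ts.ModelType.{u, v, w}, Nonempty (M ↪[L] N)
  embeds_right : ∀ N : Ts.ModelType.{u, v, w}, ∃ M : T.ModelType.{u, v, w}, Nonempty (N ↪[L] M)
  modelComplete : Theory.IsModelComplete.{u, v, w} Ts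

end ModelCompanion

/-- Unary function symbols `∂₀, ∂₁, ∂₂, …`. -/
inductive DerivFunc : ℕ → Type
  | der (k : ℕ) : DerivFunc 1

/-- The language whose only symbols are the unary function symbols `∂ₖ`, for `k` in `ℕ`. -/
def derivSymbols : Language.{0, 0} where
  Functions := DerivFunc
  Relations := fun _ => Empty

/-- The language `{0, 1, -, +, ·, ∂₀, ∂₁, …}` of rings with operators `∂ₖ`, for `k` in `ℕ`. -/
abbrev omegaDiffRing : Language.{0, 0} :=
  Language.ring.sum derivSymbols

namespace omegaDiffRing

variable {α : Type*}

/-- The inclusion of the language of rings. -/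
abbrev ofRing : Language.ring →ᴸ omegaDiffRing := LHom.sumInl

/-- The function symbol `∂ₖ`. -/
abbrev derFunc (k : ℕ) : omegaDiffRing.Functions 1 :=
  (LHom.sumInr : derivSymbols →ᴸ omegaDiffRing).onFunction (DerivFunc.der k)

/-- The term `s + t`. -/
def add (s t : omegaDiffRing.Term α) : omegaDiffRing.Term α :=
  (ofRing.onFunction Ring.addFunc).apply₂ s t

/-- The term `s · t`. -/
def mul (s t : omegaDiffRing.Term α) : omegaDiffRing.Term α :=
  (ofRing.onFunction Ring.mulFunc).apply₂ s t

/-- The term `∂ₖ t`. -/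
def der (k : ℕ) (t : omegaDiffRing.Term α) : omegaDiffRing.Term α :=
  (derFunc k).apply₁ t

/-- `∀ x y, ∂ₖ (x + y) = ∂ₖ x + ∂ₖ y` -/
def derAdd (k : ℕ) : omegaDiffRing.Sentence :=
  ∀' ∀' (der k (add (&0) (&1)) =' add (der k (&0)) (der k (&1)))

/-- `∀ x y, ∂ₖ (x · y) = ∂ₖ x · y + x · ∂ₖ y` -/
def derMul (k : ℕ) : omegaDiffRing.Sentence :=
  ∀' ∀' (der k (mul (&0) (&1)) =' add (mul (der k (&0)) (&1)) (mul (&0) (der k (&1))))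

/-- `∀ x, ∂ⱼ (∂ₖ x) = ∂ₖ (∂ⱼ x)` -/
def derComm (j k : ℕ) : omegaDiffRing.Sentence :=
  ∀' (der j (der k (&0)) =' der k (der j (&0)))

end omegaDiffRing

/-- The theory `ωDF` of fields (of any characteristic) with commuting derivations `∂₀, ∂₁, …`. -/
def omegaDF : omegaDiffRing.Theory :=
  omegaDiffRing.ofRing.onTheory Theory.field ∪
    (Set.range omegaDiffRing.derAdd ∪ Set.range omegaDiffRing.derMul ∪
      {φ | ∃ j k : ℕ, φ = omegaDiffRing.derComm j k})

end FirstOrder.Language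

/-! Being a square is the obstruction. If all `∂ₖ` kill `c`, a square root of `c` can be adjoined
with every `∂ₖ` killing it too (`exists_embedding_isSq`). By model-completeness, such a `c` in a
model of a model-companion is already a square there. But in characteristic two a square is killed
by every derivation, so a `c` with `∂ₙ c = 1` never becomes a square, even if all other `∂ₖ` kill
it; such a `c` exists for every `n` (`exists_model_der_eq_one`). A nonprincipal ultraproduct over
`n` then gives a model of the companion with a non-square killed by all `∂ₖ`
(`exists_model_not_isSq_forall_der_eq_zero`), a contradiction. Infinitely many derivations are
essential: no finite set of the conditions `∂ₖ c = 0` forces `c` to be a square. -/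

namespace FirstOrder.Language

open Structure

/-! ### Model-completeness and elementary embeddings -/

section QuantifierFree

variable {L : Language.{u, v}} {α : Type*} {n : ℕ} {M N : Type*} [L.Structure M] [L.Structure N]

/-- Embeddings preserve and reflect quantifier-free formulas. -/
theorem BoundedFormula.IsQF.realize_embedding_iff {φ : L.BoundedFormula α n} (hφ : φ.IsQF)
    (f : M ↪[L] N) (v : α → M) (xs : Fin n → M) :
    φ.Realize (f ∘ v) (f ∘ xs) ↔ φ.Realize v xs := by
  induction hφ with
  | falsum => rfl
  | of_isAtomic h =>
    cases h with
    | equal t₁ t₂ =>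
      simp only [Term.bdEqual, BoundedFormula.Realize, ← Sum.comp_elim, HomClass.realize_term,
        f.injective.eq_iff]
    | rel R ts =>
      simp only [Relations.boundedFormula, BoundedFormula.Realize, ← Sum.comp_elim,
        HomClass.realize_term]
      exact f.map_rel R _
  | imp _ _ ih₁ ih₂ => simp only [BoundedFormula.realize_imp, ih₁, ih₂]

/-- Over a model-complete theory, embeddings between models are elementary. -/
theorem Theory.IsModelComplete.realize_embedding_iff {T : L.Theory}
    (hT : Theory.IsModelComplete.{u, v, w} T) {P N : Type w} [L.Structure P] [L.Structure N]
    [P ⊨ T] [N ⊨ T] [Nonempty P] [Nonempty N] (f : P ↪[L] N) (φ : L.Formula P) :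
    φ.Realize f ↔ φ.Realize id := by
  have hc := hT (Theory.ModelType.of T P)
  let T' : L[[P]].Theory := (L.lhomWithConstants P).onTheory T ∪ L.diagram P
  change T'.IsComplete at hc
  -- Naming the elements of `P` in `N` through `f` makes `N`, like `P`, a model of the complete
  -- theory `T'`, so both satisfy the same sentences with parameters from `P`.
  let : (constantsOn P).Structure N := constantsOn.structure f
  let g : P ↪[L[[P]]] N :=
    { toEmbedding := f.toEmbedding
      map_fun' := by
        intro n s x
        cases s with
        | inl s => exact f.map_fun' s x
        | inr c =>
          cases n with
          | zero => rfl
          | succ n => exact isEmptyElim c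
      map_rel' := by
        intro n R x
        cases R with
        | inl R => exact f.map_rel' R x
        | inr r => exact isEmptyElim r }
  have hP : P ⊨ T' := by
    refine Theory.model_union_iff.2 ⟨(LHom.onTheory_model _ _).2 inferInstance, ?_⟩
    exact ⟨fun ψ hψ => hψ.2⟩
  have hN : N ⊨ T' := by
    refine Theory.model_union_iff.2 ⟨(LHom.onTheory_model _ _).2 inferInstance, ⟨fun ψ hψ => ?_⟩⟩
    have h := (hψ.1.realize_embedding_iff g default default).2 hψ.2
    rw [Sentence.Realize, Formula.Realize]
    convert h
  have h := (hc.realize_sentence_iff (Formula.equivSentence φ) N).trans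
    (hc.realize_sentence_iff (Formula.equivSentence φ) P).symm
  exact ((Formula.realize_equivSentence N φ).symm.trans h).trans (Formula.realize_equivSentence P φ)

end QuantifierFree

namespace omegaDiffRing

/-! ### Models of `omegaDF` as fields with commuting derivations -/

/-- A field structure and an `omegaDiffRing`-structure on the same type are compatible if the
symbols of rings have their usual meaning and the `∂ₖ` are commuting derivations. -/
class IsCommDiffField (F : Type*) [Field F] [omegaDiffRing.Structure F] : Prop where
  funMap_add (x : Fin 2 → F) : funMap (ofRing.onFunction Ring.addFunc) x = x 0 + x 1
  funMap_mul (x : Fin 2 → F) : funMap (ofRing.onFunction Ring.mulFunc) x = x 0 * x 1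
  funMap_neg (x : Fin 1 → F) : funMap (ofRing.onFunction Ring.negFunc) x = -x 0
  funMap_zero (x : Fin 0 → F) : funMap (ofRing.onFunction Ring.zeroFunc) x = 0
  funMap_one (x : Fin 0 → F) : funMap (ofRing.onFunction Ring.oneFunc) x = 1
  der_add (k : ℕ) (x y : F) :
    funMap (derFunc k) ![x + y] = funMap (derFunc k) ![x] + funMap (derFunc k) ![y]
  der_mul (k : ℕ) (x y : F) :
    funMap (derFunc k) ![x * y] = funMap (derFunc k) ![x] * y + x * funMap (derFunc k) ![y]
  der_comm (j k : ℕ) (x : F) :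
    funMap (derFunc j) ![funMap (derFunc k) ![x] ] = funMap (derFunc k) ![funMap (derFunc j) ![x] ]

open IsCommDiffField

theorem realize_derAdd (F : Type*) [omegaDiffRing.Structure F] (k : ℕ) :
    F ⊨ derAdd k ↔ ∀ x y : F, funMap (derFunc k) ![funMap (ofRing.onFunction Ring.addFunc) ![x, y] ] =
      funMap (ofRing.onFunction Ring.addFunc) ![funMap (derFunc k) ![x], funMap (derFunc k) ![y] ] := by
  simp only [derAdd, add, der, Sentence.Realize, Formula.Realize, BoundedFormula.realize_all,
    BoundedFormula.realize_bdEqual, Term.realize_functions_apply₁, Term.realize_functions_apply₂]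
  rfl

theorem realize_derMul (F : Type*) [omegaDiffRing.Structure F] (k : ℕ) :
    F ⊨ derMul k ↔ ∀ x y : F, funMap (derFunc k) ![funMap (ofRing.onFunction Ring.mulFunc) ![x, y] ] =
      funMap (ofRing.onFunction Ring.addFunc)
        ![funMap (ofRing.onFunction Ring.mulFunc) ![funMap (derFunc k) ![x], y],
          funMap (ofRing.onFunction Ring.mulFunc) ![x, funMap (derFunc k) ![y] ] ] := by
  simp only [derMul, add, mul, der, Sentence.Realize, Formula.Realize, BoundedFormula.realize_all,
    BoundedFormula.realize_bdEqual, Term.realize_functions_apply₁, Term.realize_functions_apply₂]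
  rfl

theorem realize_derComm (F : Type*) [omegaDiffRing.Structure F] (j k : ℕ) :
    F ⊨ derComm j k ↔ ∀ x : F, funMap (derFunc j) ![funMap (derFunc k) ![x] ] =
      funMap (derFunc k) ![funMap (derFunc j) ![x] ] := by
  simp only [derComm, der, Sentence.Realize, Formula.Realize, BoundedFormula.realize_all,
    BoundedFormula.realize_bdEqual, Term.realize_functions_apply₁]
  rfl

theorem IsCommDiffField.model_omegaDF (F : Type*) [Field F] [omegaDiffRing.Structure F]
    [IsCommDiffField F] : F ⊨ omegaDF := by
  let : Language.ring.Structure F := ofRing.reduct F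
  let : Ring.CompatibleRing F :=
    { funMap_add := funMap_add
      funMap_mul := funMap_mul
      funMap_neg := funMap_neg
      funMap_zero := funMap_zero
      funMap_one := funMap_one }
  have : ofRing.IsExpansionOn F := ofRing.isExpansionOn_reduct F
  refine Theory.model_union_iff.2 ⟨(LHom.onTheory_model _ _).2 inferInstance, ⟨?_⟩⟩
  rintro φ ((⟨k, rfl⟩ | ⟨k, rfl⟩) | ⟨j, k, rfl⟩)
  · exact (realize_derAdd F k).2 (by simp [der_add])
  · exact (realize_derMul F k).2 (by simp [der_mul])
  · exact (realize_derComm F j k).2 (der_comm j k)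

theorem exists_isCommDiffField (M : Type*) [omegaDiffRing.Structure M] [hM : M ⊨ omegaDF] :
    ∃ _ : Field M, IsCommDiffField M := by
  let : Language.ring.Structure M := ofRing.reduct M
  have : ofRing.IsExpansionOn M := ofRing.isExpansionOn_reduct M
  obtain ⟨hF, hD⟩ := Theory.model_union_iff.1 hM
  have : M ⊨ Theory.field := (LHom.onTheory_model _ _).1 hF
  let := Field.fieldOfModelField M
  let := Field.compatibleRingOfModelField M
  have hadd (x : Fin 2 → M) : funMap (ofRing.onFunction Ring.addFunc) x = x 0 + x 1 :=
    Ring.CompatibleRing.funMap_add x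
  have hmul (x : Fin 2 → M) : funMap (ofRing.onFunction Ring.mulFunc) x = x 0 * x 1 :=
    Ring.CompatibleRing.funMap_mul x
  refine ⟨inferInstance, hadd, hmul, Ring.CompatibleRing.funMap_neg,
    Ring.CompatibleRing.funMap_zero, Ring.CompatibleRing.funMap_one, fun k => ?_, fun k => ?_,
    fun j k => ?_⟩
  · have := (realize_derAdd M k).1 (hD.realize_of_mem _ (Or.inl (Or.inl ⟨k, rfl⟩)))
    simpa [hadd] using this
  · have := (realize_derMul M k).1 (hD.realize_of_mem _ (Or.inl (Or.inr ⟨k, rfl⟩)))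
    simpa [hadd, hmul] using this
  · exact (realize_derComm M j k).1 (hD.realize_of_mem _ (Or.inr ⟨j, k, rfl⟩))

/-- The `omegaDiffRing`-structure on a field given by a sequence of operators. -/
@[reducible]
def structureOfField (F : Type*) [Field F] (d : ℕ → F → F) : omegaDiffRing.Structure F :=
  letI := Ring.compatibleRingOfRing F
  letI : derivSymbols.Structure F :=
    { funMap := fun {_} f x => match f with | .der k => d k (x 0)
      RelMap := fun r _ => r.elim }
  inferInstance

theorem isCommDiffField_structureOfField {F : Type*} [Field F] {d : ℕ → F → F}
    (hadd : ∀ k x y, d k (x + y) = d k x + d k y)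
    (hmul : ∀ k x y, d k (x * y) = d k x * y + x * d k y)
    (hcomm : ∀ j k x, d j (d k x) = d k (d j x)) :
    letI := structureOfField F d
    IsCommDiffField F :=
  letI := structureOfField F d
  ⟨fun _ => rfl, fun _ => rfl, fun _ => rfl, fun _ => rfl, fun _ => rfl, hadd, hmul, hcomm⟩

/-- A ring homomorphism of fields that commutes with the `∂ₖ` is an embedding of structures. -/
def embeddingOfRingHom {F K : Type*} [Field F] [Field K] [omegaDiffRing.Structure F]
    [omegaDiffRing.Structure K] [IsCommDiffField F] [IsCommDiffField K] (f : F →+* K)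
    (hf : ∀ k x, f (funMap (derFunc k) ![x]) = funMap (derFunc k) ![f x]) :
    F ↪[omegaDiffRing] K where
  toFun := f
  inj' := f.injective
  map_fun' := by
    rintro n (s | s) x
    · cases s
      · exact ((congrArg f (funMap_add x)).trans (map_add f _ _)).trans (funMap_add (f ∘ x)).symm
      · exact ((congrArg f (funMap_mul x)).trans (map_mul f _ _)).trans (funMap_mul (f ∘ x)).symm
      · exact ((congrArg f (funMap_neg x)).trans (map_neg f _)).trans (funMap_neg (f ∘ x)).symm
      · exact ((congrArg f (funMap_zero x)).trans (map_zero f)).trans (funMap_zero (f ∘ x)).symm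
      · exact ((congrArg f (funMap_one x)).trans (map_one f)).trans (funMap_one (f ∘ x)).symm
    · cases s with
      | der k =>
        have hx : x = ![x 0] := by ext i; fin_cases i; rfl
        have hfx : f ∘ x = ![f (x 0)] := by ext i; fin_cases i; rfl
        rw [hfx, hx]
        exact hf k (x 0)
  map_rel' := by
    rintro n (r | r)
    · exact isEmptyElim r
    · exact r.elim

/-! ### Formulas for squares and constants, and their behaviour under embeddings -/

/-- The element `c` is a square, in terms of the interpretation of the symbol `·`. -/
def IsSq {M : Type*} [omegaDiffRing.Structure M] (c : M) : Prop :=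
  ∃ y : M, funMap (ofRing.onFunction Ring.mulFunc) ![y, y] = c

/-- The formula `∃ y, y · y = a` in the free variable `a`. -/
def isSqFormula {α : Type*} (a : α) : omegaDiffRing.Formula α :=
  BoundedFormula.ex (mul (&0) (&0) =' Term.var (Sum.inl a))

theorem realize_isSqFormula {α M : Type*} [omegaDiffRing.Structure M] (a : α) (v : α → M) :
    (isSqFormula a).Realize v ↔ IsSq (v a) := by
  simp only [isSqFormula, IsSq, mul, Formula.Realize, BoundedFormula.realize_ex,
    BoundedFormula.realize_bdEqual, Term.realize_functions_apply₂]
  rfl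

/-- The formula `∂ₖ a = 0` in the free variable `a`. -/
def derEqZeroFormula {α : Type*} (k : ℕ) (a : α) : omegaDiffRing.Formula α :=
  (der k (Term.var a)).equal (Constants.term (ofRing.onFunction Ring.zeroFunc))

theorem realize_derEqZeroFormula {α M : Type*} [omegaDiffRing.Structure M] (k : ℕ) (a : α)
    (v : α → M) : (derEqZeroFormula k a).Realize v ↔
      funMap (derFunc k) ![v a] = funMap (ofRing.onFunction Ring.zeroFunc) ![] := by
  simp only [derEqZeroFormula, der, Formula.realize_equal, Term.realize_functions_apply₁,
    Term.realize_var, Term.realize_constants]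
  rw [constantMap, Subsingleton.elim (default : Fin 0 → M) ![] ]

theorem map_derFunc {M N : Type*} [omegaDiffRing.Structure M] [omegaDiffRing.Structure N]
    (f : M ↪[omegaDiffRing] N) (k : ℕ) (x : M) :
    f (funMap (derFunc k) ![x]) = funMap (derFunc k) ![f x] := by
  rw [f.map_fun]
  congr 1
  ext i; fin_cases i; rfl

theorem map_nullary {M N : Type*} [omegaDiffRing.Structure M] [omegaDiffRing.Structure N]
    (f : M ↪[omegaDiffRing] N) (s : omegaDiffRing.Functions 0) :
    f (funMap s ![]) = funMap s ![] := by
  rw [f.map_fun]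
  congr 1
  exact Subsingleton.elim _ _

theorem map_binary {M N : Type*} [omegaDiffRing.Structure M] [omegaDiffRing.Structure N]
    (f : M ↪[omegaDiffRing] N) (s : omegaDiffRing.Functions 2) (x y : M) :
    f (funMap s ![x, y]) = funMap s ![f x, f y] := by
  rw [f.map_fun]
  congr 1
  ext i; fin_cases i <;> rfl

theorem IsSq.map {M N : Type*} [omegaDiffRing.Structure M] [omegaDiffRing.Structure N]
    (f : M ↪[omegaDiffRing] N) {c : M} (hc : IsSq c) : IsSq (f c) := by
  obtain ⟨y, rfl⟩ := hc
  exact ⟨f y, (map_binary f _ y y).symm⟩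

/-! ### Adjoining square roots, and obstructions to them -/

/-- An element of a model of `omegaDF` that is constant with respect to each `∂ₖ` is a square in
some extension. -/
theorem exists_embedding_isSq (M : Type w) [omegaDiffRing.Structure M] [M ⊨ omegaDF] (c : M)
    (hc : ∀ k, funMap (derFunc k) ![c] = funMap (ofRing.onFunction Ring.zeroFunc) ![]) :
    ∃ (N : omegaDF.ModelType.{0, 0, w}) (f : M ↪[omegaDiffRing] N), IsSq (f c) := by
  by_cases hsq : IsSq c
  · have : Nonempty M := ⟨c⟩
    exact ⟨Theory.ModelType.of omegaDF M, Embedding.refl _ _, hsq⟩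
  obtain ⟨_, _⟩ := exists_isCommDiffField M
  replace hc (k : ℕ) : funMap (derFunc k) ![c] = (0 : M) := (hc k).trans (funMap_zero _)
  -- This is what makes the quadratic algebra with `ω² = c` a field.
  have : Fact (∀ r : M, r ^ 2 ≠ c + 0 * r) := ⟨fun r hr => hsq ⟨r, by
    rw [funMap_mul]
    simpa [sq] using hr⟩⟩
  have h0 (k : ℕ) : funMap (derFunc k) ![(0 : M)] = 0 := by simpa using der_add k (0 : M) 0
  -- Acting coefficientwise means `∂ₖ ω = 0`, which is consistent with `ω² = c` because `∂ₖ c = 0`.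
  let d : ℕ → (QuadraticAlgebra M c 0) → (QuadraticAlgebra M c 0) := fun k x => ⟨funMap (derFunc k) ![x.re], funMap (derFunc k) ![x.im]⟩
  let := structureOfField (QuadraticAlgebra M c 0) d
  have : IsCommDiffField (QuadraticAlgebra M c 0) := isCommDiffField_structureOfField
    (fun k x y => by ext <;> simp [d, der_add])
    (fun k x y => by
      ext
      · simp [d, der_add, der_mul, hc]; ring
      · simp [d, der_add, der_mul]; ring)
    (fun j k x => by ext <;> simp [d, der_comm j k])
  have := IsCommDiffField.model_omegaDF (QuadraticAlgebra M c 0)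
  let f : M ↪[omegaDiffRing] (QuadraticAlgebra M c 0) := embeddingOfRingHom (algebraMap M (QuadraticAlgebra M c 0)) fun k x => by
    change _ = d k _
    ext <;> simp [d, h0]
  refine ⟨Theory.ModelType.of omegaDF (QuadraticAlgebra M c 0), f, QuadraticAlgebra.omega, ?_⟩
  refine (funMap_mul (F := (QuadraticAlgebra M c 0)) _).trans ?_
  change (QuadraticAlgebra.omega * QuadraticAlgebra.omega : (QuadraticAlgebra M c 0)) = algebraMap M (QuadraticAlgebra M c 0) c
  rw [QuadraticAlgebra.omega_mul_omega_eq_mk]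
  ext <;> simp 

/-- A nonzero square has even degree, while `X` has degree one. -/
theorem not_isSquare_X (k : Type*) [Field k] : ¬ IsSquare (RatFunc.X : RatFunc k) := by
  rintro ⟨r, hr⟩
  have hr0 : r ≠ 0 := by
    rintro rfl
    exact RatFunc.X_ne_zero (by simpa using hr)
  have h := congrArg RatFunc.intDegree hr
  rw [RatFunc.intDegree_X, RatFunc.intDegree_mul hr0 hr0] at h
  omega

/-- A non-square element `t` of a field `F` of characteristic two yields, for each `n`, a model of
`omegaDF` on `F(√t)` with an element whose
`∂ₖ`-derivatives vanish except for `k = n`, when the derivative is `1`. -/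
theorem exists_model_der_eq_one_of_not_isSquare {F : Type w} [Field F] (h2F : (2 : F) = 0) {t : F}
    (ht : ¬ IsSquare t) (n : ℕ) :
    ∃ (M : omegaDF.ModelType.{0, 0, w}) (c : M),
      funMap (ofRing.onFunction Ring.addFunc) ![(funMap (ofRing.onFunction Ring.oneFunc) ![] : M),
        funMap (ofRing.onFunction Ring.oneFunc) ![] ] = funMap (ofRing.onFunction Ring.zeroFunc) ![] ∧
      (∀ k, k ≠ n → funMap (derFunc k) ![c] = funMap (ofRing.onFunction Ring.zeroFunc) ![]) ∧
      funMap (derFunc n) ![c] = funMap (ofRing.onFunction Ring.oneFunc) ![] := by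
  have : Fact (∀ r : F, r ^ 2 ≠ t + 0 * r) := ⟨fun r hr => ht ⟨r, by simpa [sq] using hr.symm⟩⟩
  -- `∂ₙ` is the `F`-linear derivation with `ω ↦ 1`. Since it kills `t = ω²`, Leibniz requires `2ω =
  -- 0`, hence characteristic two. The other derivations are zero, so all commute.
  let d : ℕ → QuadraticAlgebra F t 0 → QuadraticAlgebra F t 0 :=
    fun k x => if k = n then ⟨x.im, 0⟩ else 0
  let := structureOfField (QuadraticAlgebra F t 0) d
  have : IsCommDiffField (QuadraticAlgebra F t 0) := isCommDiffField_structureOfField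
    (fun k x y => by by_cases hk : k = n <;> ext <;> simp [d, hk])
    (fun k x y => by
      by_cases hk : k = n
      · ext
        · simp [d, hk]; ring
        · simp [d, hk]; linear_combination (-x.im * y.im) * h2F
      · simp [d, hk])
    (fun j k x => by by_cases hk : k = n <;> by_cases hj : j = n <;> ext <;> simp [d, hk, hj])
  have := IsCommDiffField.model_omegaDF (QuadraticAlgebra F t 0)
  refine ⟨Theory.ModelType.of omegaDF (QuadraticAlgebra F t 0),
    (QuadraticAlgebra.omega : QuadraticAlgebra F t 0), ?_, fun k hk => ?_, ?_⟩
  · change (1 + 1 : QuadraticAlgebra F t 0) = 0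
    ext
    · exact one_add_one_eq_two.trans h2F
    · exact add_zero 0
  · change d k _ = 0
    simp [d, hk]
  · change d n _ = 1
    simp only [d, if_pos]
    rfl

/-- For each `n` there is a model of `omegaDF` of characteristic two with an element whose
`∂ₖ`-derivatives vanish except for `k = n`, when the derivative is `1`. -/
theorem exists_model_der_eq_one (n : ℕ) :
    ∃ (M : omegaDF.ModelType.{0, 0, w}) (c : M),
      funMap (ofRing.onFunction Ring.addFunc) ![(funMap (ofRing.onFunction Ring.oneFunc) ![] : M),
        funMap (ofRing.onFunction Ring.oneFunc) ![] ] = funMap (ofRing.onFunction Ring.zeroFunc) ![] ∧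
      (∀ k, k ≠ n → funMap (derFunc k) ![c] = funMap (ofRing.onFunction Ring.zeroFunc) ![]) ∧
      funMap (derFunc n) ![c] = funMap (ofRing.onFunction Ring.oneFunc) ![] := by
  have h2 : (2 : ULift.{w} (ZMod 2)) = 0 := ULift.ext _ _ (by decide)
  refine exists_model_der_eq_one_of_not_isSquare ?_ (not_isSquare_X (ULift.{w} (ZMod 2))) n
  have h := congrArg (algebraMap (ULift.{w} (ZMod 2)) (RatFunc (ULift.{w} (ZMod 2)))) h2
  rwa [map_ofNat, map_zero] at h

/-- In characteristic two, a square has derivative zero. -/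
theorem not_isSq_of_der_eq_one (M : Type*) [omegaDiffRing.Structure M] [M ⊨ omegaDF] {c : M} {n : ℕ}
    (h2 : funMap (ofRing.onFunction Ring.addFunc)
      ![(funMap (ofRing.onFunction Ring.oneFunc) ![] : M),
        funMap (ofRing.onFunction Ring.oneFunc) ![] ] = funMap (ofRing.onFunction Ring.zeroFunc) ![])
    (hn : funMap (derFunc n) ![c] = funMap (ofRing.onFunction Ring.oneFunc) ![]) : ¬ IsSq c := by
  obtain ⟨_, _⟩ := exists_isCommDiffField M
  rintro ⟨y, rfl⟩
  simp only [funMap_add, funMap_one, funMap_zero, funMap_mul, der_mul, Matrix.cons_val_zero,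
    Matrix.cons_val_one] at h2 hn
  exact one_ne_zero (α := M) (by linear_combination -hn + y * funMap (derFunc n) ![y] * h2)

/-! ### Non-squares in models of a model-companion -/

/-- A model-companion of `omegaDF` has, for each `n`, a model with a non-square element that is
constant with respect to `∂ₖ` whenever `k < n`. -/
theorem exists_model_not_isSq {Ts : omegaDiffRing.Theory}
    (hTs : Theory.IsModelCompanion.{0, 0, w} Ts omegaDF) (n : ℕ) :
    ∃ (M : Ts.ModelType.{0, 0, w}) (c : M), ¬ IsSq c ∧
      ∀ k, k < n → funMap (derFunc k) ![c] = funMap (ofRing.onFunction Ring.zeroFunc) ![] := by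
  obtain ⟨M, c, h2, h0, h1⟩ := exists_model_der_eq_one.{w} n
  obtain ⟨N, ⟨f⟩⟩ := hTs.embeds_left M
  obtain ⟨M', ⟨g⟩⟩ := hTs.embeds_right N
  refine ⟨N, f c, fun hsq => ?_, fun k hk => ?_⟩
  · refine not_isSq_of_der_eq_one M' (c := g (f c)) (n := n) ?_ ?_ (hsq.map g)
    · simpa only [map_binary, map_nullary] using congrArg (fun x => g (f x)) h2
    · simpa only [map_derFunc, map_nullary] using congrArg (fun x => g (f x)) h1
  · simpa only [map_derFunc, map_nullary] using congrArg f (h0 k hk.ne)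

/-- A model-companion of `omegaDF` has a model with a non-square element that is constant with
respect to every `∂ₖ`. -/
theorem exists_model_not_isSq_forall_der_eq_zero {Ts : omegaDiffRing.Theory}
    (hTs : Theory.IsModelCompanion.{0, 0, w} Ts omegaDF) :
    ∃ (M : Ts.ModelType.{0, 0, w}) (c : M), ¬ IsSq c ∧
      ∀ k, funMap (derFunc k) ![c] = funMap (ofRing.onFunction Ring.zeroFunc) ![] := by
  choose M c hsq hder using exists_model_not_isSq hTs
  -- Nonprincipality ensures that each fixed `k` satisfies `k < n` for almost all `n`.
  let U : Ultrafilter ℕ := Filter.hyperfilter ℕ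
  let P : Type w := (U : Filter ℕ).Product fun n => M n
  let : omegaDiffRing.Structure P := Ultraproduct.structure
  have : P ⊨ Ts := ⟨fun φ hφ => (Ultraproduct.sentence_realize φ).2
    (Filter.Eventually.of_forall fun n => Theory.realize_sentence_of_mem Ts hφ)⟩
  have : Nonempty P := Ultraproduct.Product.instNonempty
  have key (φ : omegaDiffRing.Formula Unit) :=
    Ultraproduct.realize_formula_cast (u := U) (M := fun n => M n) φ fun _ => c
  refine ⟨Theory.ModelType.of Ts P, ((c : (U : Filter ℕ).Product fun n => M n) : P), ?_, ?_⟩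
  · have h := key (isSqFormula ()).not
    simp only [Formula.realize_not, realize_isSqFormula] at h
    exact h.2 (Filter.Eventually.of_forall hsq)
  · intro k
    have h := key (derEqZeroFormula k ())
    simp only [realize_derEqZeroFormula] at h
    exact h.2 (((Filter.eventually_gt_atTop k).filter_mono Nat.hyperfilter_le_atTop).mono
      fun n hn => hder n k hn)

end omegaDiffRing

end FirstOrder.Language

open FirstOrder.Language FirstOrder.Language.omegaDiffRing in
theorem theorem3 :
    ¬ ∃ Ts : FirstOrder.Language.omegaDiffRing.Theory,
      FirstOrder.Language.Theory.IsModelCompanion.{0, 0, w} Ts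
        FirstOrder.Language.omegaDF := by
  rintro ⟨Ts, hTs⟩
  obtain ⟨P, c, hsq, hder⟩ := exists_model_not_isSq_forall_der_eq_zero hTs
  obtain ⟨M, ⟨f⟩⟩ := hTs.embeds_right P
  obtain ⟨M', g, hg⟩ := exists_embedding_isSq M (f c) fun k => by
    simpa only [map_derFunc, map_nullary] using congrArg f (hder k)
  obtain ⟨N, ⟨h⟩⟩ := hTs.embeds_left M'
  -- In the chain `P → M → M' → N` the ends are models of `Ts`, so the composite is elementary and
  -- the square root found in `M'` is reflected to `P`.
  have hN : (isSqFormula c).Realize (h.comp (g.comp f)) :=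
    (realize_isSqFormula _ _).2 (hg.map h)
  exact hsq ((realize_isSqFormula c id).1
    ((hTs.modelComplete.realize_embedding_iff (h.comp (g.comp f)) _).1 hN))
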